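/- Let $\mathcal S,\mathcal A$ be finite sets. A (time-homogeneous) MDP $M=(\mathcal S,\mathcal A,\bar r,p,s_1)$ consists of mean rewards $\bar r(s,a)\in\mathbb R$, transition probabilities $p(s'|s,a)$ and an initial state $s_1\in\mathcal S$; it is communicating if from every state every other state can be reached with positive probability by choosing appropriate actions. For a stationary policy $\pi:\mathcal S\to\mathcal A$ let $\rho(M,\pi,s)=\lim_{T\to\infty}\frac1T\,\mathbb E_s^{\pi}\big[\sum_{t=1}^{T}\bar r(s_t,\pi(s_t))\big]$ be its average reward when starting in $s$, and let $\rho^*(M)=\max_\pi\rho(M,\pi,s_1)$. A policy is optimal if it maximizes $\rho(M,\pi,s)$ for every state $s$. The bias function of $\pi$ is the Cesàro limit (as $N\to\infty$) $\lambda(s)=\operatorname{C-lim}_{N\to\infty}\mathbb E_s^\pi\big[\sum_{t=1}^{N}\big(\bar r(s_t,\pi(s_t))-\rho(M,\pi,s_t)\big)\big]$, and its bias span is $\max_s\lambda(s)-\min_s\lambda(s)$. Let $M=(\mathcal S,\mathcal A,\bar r,p,s_1)$ and $M'=(\mathcal S,\mathcal A,\bar r',p',s_1)$ be communicating MDPs,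 let $\pi'^*$ be an optimal policy of $M'$ with bias span $\Lambda'$ (on $M'$), and let $\Delta^r,\Delta^p\in\mathbb R$ be such that for every state $s$ $$\big|\bar r(s,\pi'^*(s))-\bar r'(s,\pi'^*(s))\big|\le\Delta^r,\qquad \sum_{s'}\big|p(s'|s,\pi'^*(s))-p'(s'|s,\pi'^*(s))\big|\le\Delta^p .$$ Then $$\rho^*(M')-\rho^*(M)\le\Lambda'\,\Delta^p+\Delta^r .$$ -/

import Mathlib

open Filter Topology

/-- A (time-homogeneous) Markov decision process with state space `S` and action space `A`:
mean rewards `r s a`, transition probabilities `p s a s'` of moving from `s` to `s'` under the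
action `a`, and an initial state. -/
structure MDP (S A : Type*) [Fintype S] where
  r : S → A → ℝ
  p : S → A → S → ℝ
  p_nonneg : ∀ s a s', 0 ≤ p s a s'
  p_sum : ∀ s a, ∑ s', p s a s' = 1
  init : S

noncomputable section

namespace MDP

variable {S A : Type*} [Fintype S]

/-- Every state can be reached from every state with positive probability by choosing
appropriate actions. -/
def Communicating (M : MDP S A) : Prop :=
  ∀ s s' : S, Relation.ReflTransGen (fun x y => ∃ a, 0 < M.p x a y) s s'

/-- The transition matrix of the Markov chain of states under the stationary policy `π`. -/
def transMatrix (M : MDP S A) (π : S → A) : Matrix S S ℝ :=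
  Matrix.of fun s s' => M.p s (π s) s'

variable [DecidableEq S]

/-- The expectation of `f` at the state occupied after `t` steps (`t = 0` is the start), when
starting in `s` and following `π`; that state equals `s'` with probability
`(transMatrix M π ^ t) s s'`. -/
def expect (M : MDP S A) (π : S → A) (s : S) (t : ℕ) (f : S → ℝ) : ℝ :=
  ∑ s', (M.transMatrix π ^ t) s s' * f s'

/-- The expected reward accumulated in the first `T` steps. -/
def totalReward (M : MDP S A) (π : S → A) (s : S) (T : ℕ) : ℝ :=
  ∑ t ∈ Finset.range T, M.expect π s t (fun x => M.r x (π x))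

/-- The average reward of the stationary policy `π` when starting in `s`. (The limit exists for
every policy, since the state space is finite.) -/
def avgReward (M : MDP S A) (π : S → A) (s : S) : ℝ :=
  limUnder atTop (fun T : ℕ => (1 / (T : ℝ)) * M.totalReward π s T)

/-- The optimal average reward: the maximum over all stationary policies of the average reward
when starting in the initial state. -/
def optAvgReward (M : MDP S A) : ℝ :=
  ⨆ π : S → A, M.avgReward π M.init

/-- `π` is an optimal policy: it maximizes the average reward from every starting state. -/
def IsOptimal (M : MDP S A) (π : S → A) : Prop :=
  ∀ (s : S) (σ : S → A), M.avgReward σ s ≤ M.avgReward π s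

/-- The bias function of `π`: the Cesàro limit, as `N → ∞`, of the expected total difference
between the reward and the average reward in the first `N` steps when starting in `s`. (The limit
exists for every policy, since the state space is finite.) -/
def bias (M : MDP S A) (π : S → A) (s : S) : ℝ :=
  limUnder atTop (fun N : ℕ => (1 / (N : ℝ)) * ∑ k ∈ Finset.range N,
    ∑ t ∈ Finset.range (k + 1), M.expect π s t (fun x => M.r x (π x) - M.avgReward π x))

/-- The span (maximum minus minimum) of the bias function of `π`. -/
def biasSpan (M : MDP S A) (π : S → A) : ℝ :=
  (⨆ s, M.bias π s) - ⨅ s, M.bias π s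

end MDP

end

/-!
Let `P` be the transition matrix of a stationary policy. Its powers are bounded, so the kernel and
the range of `1 - P` are complementary, and every reward vector `f` can be written as
`f = g + h - P h` with `P g = g` and `h` in the range of `1 - P`
(`exists_fixed_add_sub_mulVec`). Summing along the powers of `P` and taking Cesàro means identifies
`g` with the average reward and `h` with the bias function. Hence the limits in their definitions
exist, the average reward is harmonic, and the Poisson equation `r = ρ + λ - P λ` holds
(`MDP.mulVec_avgReward`, `MDP.reward_eq`).

In a communicating MDP the average reward of an optimal policy `π` is constant
(`MDP.IsOptimal.avgReward_eq`): the set `X` of states where it is maximal is closed under `π`, and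
the policy which follows `π` on `X` and moves closer to `X` elsewhere has a harmonic average
reward which equals the maximum on `X`, and which by the minimum principle is nowhere smaller.

Let `λ` be the bias function of the optimal policy of `M'`, and `P`, `P'` the transition matrices
of this policy on `M` and `M'`. The Poisson equation on `M'` shows that the rewards collected on `M`
are at least `c + λ - P λ`, where `c = ρ*(M') - Δʳ - span(λ) Δᵖ`, since `(P' - P) λ` is at
most `span(λ) Δᵖ`. The Cesàro means of the telescoping part `λ - P λ` vanish, so this policy has average
reward at least `c` on `M` (`MDP.le_avgReward_of_forall_le`).
-/

/-! ### Cesàro means and harmonic vectors of row-stochastic matrices -/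

section RowStochastic

open Matrix

variable {S : Type*} [Fintype S] [DecidableEq S] {P : Matrix S S ℝ}

/-- A row-stochastic matrix is a contraction for the supremum norm. -/
theorem norm_mulVec_le_of_mem_rowStochastic (hP : P ∈ rowStochastic ℝ S) (v : S → ℝ) :
    ‖P *ᵥ v‖ ≤ ‖v‖ := by
  refine (pi_norm_le_iff_of_nonneg (norm_nonneg v)).2 fun i => ?_
  calc ‖(P *ᵥ v) i‖ ≤ ∑ j, ‖P i j * v j‖ := norm_sum_le _ _
    _ ≤ ∑ j, P i j * ‖v‖ := by
        refine Finset.sum_le_sum fun j _ => ?_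
        rw [norm_mul, Real.norm_of_nonneg (nonneg_of_mem_rowStochastic hP)]
        exact mul_le_mul_of_nonneg_left (norm_le_pi_norm v j) (nonneg_of_mem_rowStochastic hP)
    _ = ‖v‖ := by rw [← Finset.sum_mul, sum_row_of_mem_rowStochastic hP, one_mul]

theorem sum_range_pow_mulVec_sub (P : Matrix S S ℝ) (v : S → ℝ) (N : ℕ) :
    ∑ k ∈ Finset.range N, P ^ k *ᵥ (v - P *ᵥ v) = v - P ^ N *ᵥ v := by
  have h : ∀ k, P ^ k *ᵥ (v - P *ᵥ v) = P ^ k *ᵥ v - P ^ (k + 1) *ᵥ v := fun k => by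
    rw [mulVec_sub, mulVec_mulVec, ← pow_succ]
  simp only [h, Finset.sum_range_sub', pow_zero, one_mulVec]

theorem pow_mulVec_eq_self {v : S → ℝ} (hv : P *ᵥ v = v) (k : ℕ) : P ^ k *ᵥ v = v := by
  induction k with
  | zero => simp
  | succ k ih => rw [pow_succ, ← mulVec_mulVec, hv, ih]

theorem tendsto_one_div_mul_of_abs_le {u : ℕ → ℝ} {C : ℝ} (hu : ∀ n, |u n| ≤ C) :
    Tendsto (fun N : ℕ => 1 / (N : ℝ) * u N) atTop (𝓝 0) := by
  refine squeeze_zero_norm (a := fun N : ℕ => C / (N : ℝ)) (fun N => ?_)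
    (tendsto_const_nhds.div_atTop tendsto_natCast_atTop_atTop)
  rw [Real.norm_eq_abs, abs_mul, abs_of_nonneg (by positivity : (0 : ℝ) ≤ 1 / N), one_div,
    div_eq_inv_mul]
  gcongr
  exact hu N

theorem tendsto_one_div_mul_natCast_mul (c : ℝ) :
    Tendsto (fun N : ℕ => 1 / (N : ℝ) * (N * c)) atTop (𝓝 c) := by
  refine tendsto_const_nhds.congr' ((eventually_ne_atTop 0).mono fun N hN => ?_)
  have : (N : ℝ) ≠ 0 := Nat.cast_ne_zero.2 hN
  field_simp

theorem abs_sub_pow_mulVec_le (hP : P ∈ rowStochastic ℝ S) (v : S → ℝ) (N : ℕ) (s : S) :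
    |(v - P ^ N *ᵥ v) s| ≤ ‖v‖ + ‖v‖ :=
  calc |(v - P ^ N *ᵥ v) s| ≤ ‖v - P ^ N *ᵥ v‖ := norm_le_pi_norm (v - P ^ N *ᵥ v) s
    _ ≤ ‖v‖ + ‖P ^ N *ᵥ v‖ := norm_sub_le _ _
    _ ≤ ‖v‖ + ‖v‖ := by gcongr; exact norm_mulVec_le_of_mem_rowStochastic (pow_mem hP N) v

theorem tendsto_cesaro_sub_mulVec (hP : P ∈ rowStochastic ℝ S) (v : S → ℝ) (s : S) :
    Tendsto (fun N : ℕ => 1 / (N : ℝ) * ∑ k ∈ Finset.range N, (P ^ k *ᵥ (v - P *ᵥ v)) s)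
      atTop (𝓝 0) := by
  refine tendsto_one_div_mul_of_abs_le (C := ‖v‖ + ‖v‖) fun N => ?_
  rw [← Finset.sum_apply, sum_range_pow_mulVec_sub]
  exact abs_sub_pow_mulVec_le hP v N s

/-- If `x = y - P y` is fixed by `P`, then `n x = y - P ^ n y` is bounded in `n`, so `x = 0`. -/
theorem disjoint_ker_range_one_sub (hP : P ∈ rowStochastic ℝ S) :
    Disjoint (LinearMap.ker (1 - P).mulVecLin) (LinearMap.range (1 - P).mulVecLin) := by
  rw [Submodule.disjoint_def]
  rintro x hx ⟨y, rfl⟩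
  simp only [LinearMap.mem_ker, mulVecLin_apply, sub_mulVec, one_mulVec] at hx ⊢
  have hfix := pow_mulVec_eq_self (sub_eq_zero.1 hx).symm
  ext s
  have h0 := tendsto_cesaro_sub_mulVec hP y s
  simp only [hfix, Finset.sum_const, Finset.card_range, nsmul_eq_mul] at h0
  exact tendsto_nhds_unique (tendsto_one_div_mul_natCast_mul _) h0

/-- The correction `h` can be taken in the range of `1 - P`, so that the Cesàro means of `P ^ k h`
vanish; this normalization is what singles out the bias function. -/
theorem exists_fixed_add_sub_mulVec (hP : P ∈ rowStochastic ℝ S) (f : S → ℝ) :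
    ∃ g w : S → ℝ, P *ᵥ g = g ∧ f = g + (w - P *ᵥ w) - P *ᵥ (w - P *ᵥ w) := by
  have htop : LinearMap.ker (1 - P).mulVecLin ⊔ LinearMap.range (1 - P).mulVecLin = ⊤ := by
    refine Submodule.eq_top_of_disjoint _ _ ?_ (disjoint_ker_range_one_sub hP)
    rw [add_comm, LinearMap.finrank_range_add_finrank_ker]
  have key : ∀ x : S → ℝ, ∃ g w : S → ℝ, P *ᵥ g = g ∧ x = g + (w - P *ᵥ w) := fun x => by
    obtain ⟨g, hg, _, ⟨w, rfl⟩, hx⟩ := Submodule.mem_sup.1 (htop ▸ Submodule.mem_top : x ∈ _)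
    simp only [LinearMap.mem_ker, mulVecLin_apply, sub_mulVec, one_mulVec] at hg hx
    exact ⟨g, w, (sub_eq_zero.1 hg).symm, hx.symm⟩
  obtain ⟨g, w, hg, hf⟩ := key f
  -- Decomposing `w` once more replaces it by its component in the range, as `1 - P` kills the rest.
  obtain ⟨g', w', hg', rfl⟩ := key w
  refine ⟨g, w', hg, ?_⟩
  rw [hf, mulVec_add, hg']
  abel

/-- Minimum principle: a vector harmonic for `P`, with a minimum at `s`, is constant on the
successors of `s`. -/
theorem eq_of_mulVec_eq_of_forall_le (hP : P ∈ rowStochastic ℝ S) {g : S → ℝ} (hg : P *ᵥ g = g)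
    {s : S} (hs : ∀ x, g s ≤ g x) {y : S} (hy : 0 < P s y) : g y = g s := by
  have h0 : ∑ x, P s x * (g x - g s) = 0 := by
    have : ∑ x, P s x * g x = g s := congrFun hg s
    simp only [mul_sub, Finset.sum_sub_distrib, this, ← Finset.sum_mul,
      sum_row_of_mem_rowStochastic hP, one_mul, sub_self]
  have h1 := (Finset.sum_eq_zero_iff_of_nonneg fun x _ =>
    mul_nonneg (nonneg_of_mem_rowStochastic hP) (sub_nonneg.2 (hs x))).1 h0 y (Finset.mem_univ y)
  exact sub_eq_zero.1 ((mul_eq_zero.1 h1).resolve_left hy.ne')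

theorem eq_of_mulVec_eq_of_forall_ge (hP : P ∈ rowStochastic ℝ S) {g : S → ℝ} (hg : P *ᵥ g = g)
    {s : S} (hs : ∀ x, g x ≤ g s) {y : S} (hy : 0 < P s y) : g y = g s :=
  neg_injective <| eq_of_mulVec_eq_of_forall_le (g := -g) hP (by rw [mulVec_neg, hg])
    (fun x => neg_le_neg (hs x)) hy

/-- If `P` and `Q` agree on a set closed under `P`, and so do `f` and `f'`, then the expectations of
`f` and `f'` along the two chains agree there. -/
theorem pow_mulVec_eq_of_closed {Q : Matrix S S ℝ} {f f' : S → ℝ} {X : Set S}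
    (hX : ∀ s ∈ X, ∀ y, P s y ≠ 0 → y ∈ X) (hPQ : ∀ s ∈ X, P s = Q s)
    (hf : ∀ s ∈ X, f s = f' s) (k : ℕ) : ∀ s ∈ X, (P ^ k *ᵥ f) s = (Q ^ k *ᵥ f') s := by
  induction k with
  | zero => simpa using hf
  | succ k ih =>
    intro s hs
    rw [pow_succ', pow_succ', ← mulVec_mulVec, ← mulVec_mulVec]
    refine Finset.sum_congr rfl fun y _ => ?_
    rw [← hPQ s hs]
    change P s y * _ = P s y * _
    by_cases hy : P s y = 0
    · rw [hy, zero_mul, zero_mul]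
    · rw [ih y (hX s hs y hy)]

end RowStochastic

/-- For a vector of total mass zero, the pairing with `v` only sees the oscillation of `v`. -/
theorem sum_mul_le_of_sum_eq_zero {S : Type*} [Fintype S] {d v : S → ℝ} {a b : ℝ}
    (hd : ∑ x, d x = 0) (ha : ∀ x, a ≤ v x) (hb : ∀ x, v x ≤ b) :
    ∑ x, d x * v x ≤ (b - a) * ∑ x, |d x| := by
  have h : ∑ x, d x * v x = ∑ x, d x * (v x - a) := by
    simp only [mul_sub, Finset.sum_sub_distrib, ← Finset.sum_mul, hd, zero_mul, sub_zero]
  rw [h, Finset.mul_sum]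
  refine Finset.sum_le_sum fun x _ => ?_
  rw [mul_comm (b - a)]
  exact mul_le_mul (le_abs_self _) (sub_le_sub_right (hb x) a) (sub_nonneg.2 (ha x)) (abs_nonneg _)

/-- If `X` is reachable from everywhere along `R`, then some rank function (the distance to `X`) can
be decreased by a step of `R` from any point outside `X`. -/
theorem exists_rank_of_reachable {S : Type*} {R : S → S → Prop} {X : Set S} {x₀ : S} (hx₀ : x₀ ∈ X)
    (h : ∀ s, Relation.ReflTransGen R s x₀) :
    ∃ d : S → ℕ, ∀ s, s ∉ X → ∃ y, R s y ∧ d y < d s := by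
  -- `reach n s`: some path of exactly `n` steps leads from `s` into `X`.
  let reach : ℕ → S → Prop := fun n => Nat.rec (· ∈ X) (fun _ q s => ∃ y, R s y ∧ q y) n
  have hreach : ∀ s, {n | reach n s}.Nonempty := fun s => by
    induction h s using Relation.ReflTransGen.head_induction_on with
    | refl => exact ⟨0, hx₀⟩
    | head hab _ ih => exact ih.elim fun n hn => ⟨n + 1, _, hab, hn⟩
  refine ⟨fun s => sInf {n | reach n s}, fun s hs => ?_⟩
  have hmem : reach (sInf {n | reach n s}) s := Nat.sInf_mem (hreach s)
  change ∃ y, R s y ∧ sInf {n | reach n y} < sInf {n | reach n s}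
  rcases hm : sInf {n | reach n s} with _ | m
  · rw [hm] at hmem
    exact absurd hmem hs
  · rw [hm] at hmem
    obtain ⟨y, hy, hym⟩ := hmem
    exact ⟨y, hy, Nat.lt_succ_of_le (Nat.sInf_le hym)⟩

/-! ### Average reward and bias of stationary policies -/

namespace MDP

open Matrix

variable {S A : Type*} [Fintype S] [DecidableEq S] (M : MDP S A) (π : S → A)

theorem transMatrix_mem_rowStochastic : M.transMatrix π ∈ rowStochastic ℝ S :=
  mem_rowStochastic_iff_sum.2 ⟨fun s s' => M.p_nonneg s (π s) s', fun s => M.p_sum s (π s)⟩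

theorem expect_eq_mulVec (s : S) (t : ℕ) (f : S → ℝ) :
    M.expect π s t f = (M.transMatrix π ^ t *ᵥ f) s := rfl

/-- The bias function is the correction `h` of the decomposition, because the Cesàro means of
`P ^ k h` vanish. -/
theorem exists_decomposition : ∃ g h : S → ℝ,
    M.transMatrix π *ᵥ g = g ∧
    (fun x => M.r x (π x)) = g + h - M.transMatrix π *ᵥ h ∧
    (∀ s, Tendsto (fun T : ℕ => 1 / (T : ℝ) * M.totalReward π s T) atTop (𝓝 (g s))) ∧
    ∀ s, Tendsto (fun N : ℕ => 1 / (N : ℝ) * ∑ k ∈ Finset.range N, ∑ t ∈ Finset.range (k + 1),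
      M.expect π s t (fun x => M.r x (π x) - g x)) atTop (𝓝 (h s)) := by
  have hP := M.transMatrix_mem_rowStochastic π
  obtain ⟨g, w, hg, hf⟩ := exists_fixed_add_sub_mulVec hP (fun x => M.r x (π x))
  have hsum : ∀ N s, ∑ t ∈ Finset.range N, (M.transMatrix π ^ t *ᵥ (w - M.transMatrix π *ᵥ w)) s =
      (w - M.transMatrix π ^ N *ᵥ w) s := fun N s => by
    rw [← Finset.sum_apply, sum_range_pow_mulVec_sub]
  generalize hh : w - M.transMatrix π *ᵥ w = h at hf hsum
  refine ⟨g, h, hg, hf, fun s => ?_, fun s => ?_⟩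
  · have h1 := (tendsto_one_div_mul_natCast_mul (g s)).add (tendsto_cesaro_sub_mulVec hP h s)
    rw [add_zero] at h1
    refine h1.congr fun N => ?_
    simp only [totalReward, expect_eq_mulVec, hf, add_sub_assoc, mulVec_add, Pi.add_apply,
      pow_mulVec_eq_self hg, Finset.sum_add_distrib, Finset.sum_const, Finset.card_range,
      nsmul_eq_mul, mul_add]
  · have hsub : (fun x => M.r x (π x) - g x) = h - M.transMatrix π *ᵥ h := by
      have : (fun x => M.r x (π x) - g x) = (fun x => M.r x (π x)) - g := rfl
      rw [this, hf]
      abel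
    have hin : ∀ k, ∑ t ∈ Finset.range (k + 1), M.expect π s t (fun x => M.r x (π x) - g x) =
        h s - (M.transMatrix π ^ (k + 1) *ᵥ h) s := fun k => by
      simp only [hsub, expect_eq_mulVec]
      rw [← Finset.sum_apply, sum_range_pow_mulVec_sub, Pi.sub_apply]
    -- The means of `P ^ (k + 1) h` vanish, since `P h = P w - P (P w)` telescopes as well.
    have h1 := (tendsto_one_div_mul_natCast_mul (h s)).sub
      (tendsto_cesaro_sub_mulVec hP (M.transMatrix π *ᵥ w) s)
    rw [sub_zero] at h1
    refine h1.congr fun N => ?_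
    have hshift : ∀ k, (M.transMatrix π ^ k *ᵥ (M.transMatrix π *ᵥ w -
        M.transMatrix π *ᵥ M.transMatrix π *ᵥ w)) s = (M.transMatrix π ^ (k + 1) *ᵥ h) s :=
      fun k => by rw [pow_succ, ← mulVec_mulVec, ← hh, mulVec_sub (M.transMatrix π)]
    simp only [hin, hshift, Finset.sum_sub_distrib, Finset.sum_const, Finset.card_range,
      nsmul_eq_mul, mul_sub]

theorem tendsto_avgReward (s : S) :
    Tendsto (fun T : ℕ => 1 / (T : ℝ) * M.totalReward π s T) atTop (𝓝 (M.avgReward π s)) := by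
  obtain ⟨g, h, -, -, hlim, -⟩ := M.exists_decomposition π
  exact tendsto_nhds_limUnder ⟨_, hlim s⟩

theorem mulVec_avgReward : M.transMatrix π *ᵥ M.avgReward π = M.avgReward π := by
  obtain ⟨g, h, hg, -, hlim, -⟩ := M.exists_decomposition π
  rw [show M.avgReward π = g from funext fun s => (hlim s).limUnder_eq, hg]

/-- The Poisson equation: the reward is the average reward plus the expected decrease of the bias
function in one step. -/
theorem reward_eq (s : S) :
    M.r s (π s) = M.avgReward π s + M.bias π s - (M.transMatrix π *ᵥ M.bias π) s := by
  obtain ⟨g, h, -, hf, hlim, hbias⟩ := M.exists_decomposition π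
  have hg : M.avgReward π = g := funext fun s => (hlim s).limUnder_eq
  have hh : M.bias π = h := funext fun s => by
    simp only [bias, hg]
    exact (hbias s).limUnder_eq
  rw [hg, hh]
  exact congrFun hf s

/-- A lower bound on the rewards up to a telescoping term `v - P v` bounds the average reward. -/
theorem le_avgReward_of_forall_le {c : ℝ} {v : S → ℝ}
    (h : ∀ s, c + (v - M.transMatrix π *ᵥ v) s ≤ M.r s (π s)) (s : S) : c ≤ M.avgReward π s := by
  have hP := M.transMatrix_mem_rowStochastic π
  have h1 := (tendsto_one_div_mul_natCast_mul c).add (tendsto_cesaro_sub_mulVec hP v s)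
  rw [add_zero] at h1
  refine le_of_tendsto_of_tendsto' h1 (M.tendsto_avgReward π s) fun N => ?_
  rw [← mul_add]
  refine mul_le_mul_of_nonneg_left ?_ (by positivity)
  have hN : (N : ℝ) * c = ∑ _t ∈ Finset.range N, c := by simp
  rw [hN, ← Finset.sum_add_distrib]
  refine Finset.sum_le_sum fun t _ => ?_
  have hPt := pow_mem hP t
  have hc : c = ∑ x, (M.transMatrix π ^ t) s x * c := by
    rw [← Finset.sum_mul, sum_row_of_mem_rowStochastic hPt, one_mul]
  simp only [mulVec, dotProduct, expect]
  nth_rw 1 [hc]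
  rw [← Finset.sum_add_distrib]
  refine Finset.sum_le_sum fun x _ => ?_
  rw [← mul_add]
  exact mul_le_mul_of_nonneg_left (h x) (nonneg_of_mem_rowStochastic hPt)

variable {M π}

/-- In a communicating MDP, the average reward of an optimal policy does not depend on the starting
state. -/
theorem IsOptimal.avgReward_eq (hπ : M.IsOptimal π) (hM : M.Communicating) (s s' : S) :
    M.avgReward π s = M.avgReward π s' := by
  classical
  have : Nonempty S := ⟨s⟩
  obtain ⟨x₀, hx₀⟩ := Finite.exists_max (M.avgReward π)
  let X : Set S := {x | M.avgReward π x = M.avgReward π x₀}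
  have hX : ∀ x ∈ X, ∀ y, M.transMatrix π x y ≠ 0 → y ∈ X := fun x hx y hy =>
    (eq_of_mulVec_eq_of_forall_ge (M.transMatrix_mem_rowStochastic π) (M.mulVec_avgReward π)
      (fun z => (hx₀ z).trans_eq hx.symm) ((M.p_nonneg x (π x) y).lt_of_ne' hy)).trans hx
  obtain ⟨d, hd⟩ := exists_rank_of_reachable (X := X) rfl fun z => hM z x₀
  -- The policy `σ` follows `π` on `X` and has a chance to move closer to `X` elsewhere.
  have hσ' : ∀ z, ∃ a, (z ∈ X → a = π z) ∧ (z ∉ X → ∃ y, 0 < M.p z a y ∧ d y < d z) := fun z => by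
    by_cases hz : z ∈ X
    · exact ⟨π z, fun _ => rfl, fun h => absurd hz h⟩
    · obtain ⟨y, ⟨a, ha⟩, hy⟩ := hd z hz
      exact ⟨a, fun h => absurd h hz, fun _ => ⟨y, ha, hy⟩⟩
  choose σ hσX hσd using hσ'
  have hσ : ∀ x ∈ X, M.avgReward σ x = M.avgReward π x₀ := fun x hx => by
    rw [← (show M.avgReward π x = M.avgReward π x₀ from hx), avgReward, avgReward]
    congr 1
    funext T
    simp only [totalReward, expect_eq_mulVec]
    congr 1
    refine Finset.sum_congr rfl fun t _ => Eq.symm ?_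
    refine pow_mulVec_eq_of_closed hX (fun y hy => ?_) (fun y hy => ?_) t x hx
    · funext z
      simp only [transMatrix, of_apply, hσX y hy]
    · rw [hσX y hy]
  -- Among the states minimizing the average reward of `σ`, one of least rank lies in `X`.
  obtain ⟨m, hm⟩ := Finite.exists_min (M.avgReward σ)
  obtain ⟨z, hz, hzmin⟩ := Set.exists_min_image {z | M.avgReward σ z = M.avgReward σ m} d
    (Set.toFinite _) ⟨m, rfl⟩
  have hzX : z ∈ X := by
    by_contra hzX
    obtain ⟨y, hy, hyd⟩ := hσd z hzX
    have hyz := eq_of_mulVec_eq_of_forall_le (M.transMatrix_mem_rowStochastic σ)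
      (M.mulVec_avgReward σ) (fun x => (show M.avgReward σ z = M.avgReward σ m from hz) ▸ hm x) hy
    exact (hzmin y (hyz.trans hz)).not_gt hyd
  have hconst : ∀ x, M.avgReward π x = M.avgReward π x₀ := fun x => by
    refine le_antisymm (hx₀ x) ?_
    calc M.avgReward π x₀ = M.avgReward σ z := (hσ z hzX).symm
      _ = M.avgReward σ m := hz
      _ ≤ M.avgReward σ x := hm x
      _ ≤ M.avgReward π x := hπ x σ
  rw [hconst s, hconst s']

theorem IsOptimal.optAvgReward_eq (hπ : M.IsOptimal π) :
    M.optAvgReward = M.avgReward π M.init := by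
  have : Nonempty (S → A) := ⟨π⟩
  exact le_antisymm (ciSup_le (hπ M.init))
    (le_ciSup ⟨_, Set.forall_mem_range.2 (hπ M.init)⟩ π)

end MDP

/-! ### Comparison of two processes -/

theorem mainTheorem4 {S A : Type*} [Fintype S] [DecidableEq S] [Fintype A]
    (M M' : MDP S A) (hinit : M.init = M'.init)
    (hM : M.Communicating) (hM' : M'.Communicating)
    (π' : S → A) (hπ' : M'.IsOptimal π')
    (Δr Δp : ℝ)
    (hr : ∀ s, |M.r s (π' s) - M'.r s (π' s)| ≤ Δr)
    (hp : ∀ s, ∑ s', |M.p s (π' s) s' - M'.p s (π' s) s'| ≤ Δp) :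
    M'.optAvgReward - M.optAvgReward ≤ M'.biasSpan π' * Δp + Δr := by
  have hopt : M.avgReward π' M.init ≤ M.optAvgReward :=
    le_ciSup (f := fun π : S → A => M.avgReward π M.init) (Set.finite_range _).bddAbove π'
  have hle : ∀ s, M'.bias π' s ≤ ⨆ x, M'.bias π' x := le_ciSup (Set.finite_range _).bddAbove
  have hge : ∀ s, ⨅ x, M'.bias π' x ≤ M'.bias π' s := ciInf_le (Set.finite_range _).bddBelow
  have hspan : 0 ≤ M'.biasSpan π' := sub_nonneg.2 ((hge M.init).trans (hle M.init))
  have hmain := M.le_avgReward_of_forall_le π' (v := M'.bias π')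
    (c := M'.optAvgReward - (M'.biasSpan π' * Δp + Δr)) (fun s => ?_) M.init
  · linarith
  have hpoisson := M'.reward_eq π' s
  rw [hπ'.avgReward_eq hM' s M'.init, ← hπ'.optAvgReward_eq] at hpoisson
  -- Both rows of transition probabilities have mass one, so only the span of the bias matters.
  have hdiff := sum_mul_le_of_sum_eq_zero (d := fun x => M'.p s (π' s) x - M.p s (π' s) x)
    (by rw [Finset.sum_sub_distrib, M.p_sum, M'.p_sum, sub_self]) hge hle
  have hΔp : M'.biasSpan π' * ∑ x, |M'.p s (π' s) x - M.p s (π' s) x| ≤ M'.biasSpan π' * Δp := by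
    refine mul_le_mul_of_nonneg_left ?_ hspan
    simpa only [abs_sub_comm] using hp s
  simp only [sub_mul, Finset.sum_sub_distrib] at hdiff
  have hr' := (abs_le.1 (hr s)).1
  simp only [Matrix.mulVec, dotProduct, MDP.transMatrix, Matrix.of_apply, Pi.sub_apply,
    MDP.biasSpan] at *
  linarith
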